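/- Let $\Sigma=\{0,1\}$ and let $\Sigma^\star$ be the set of finite strings over $\Sigma$. A next-token generator is a function $f:\Sigma^\star\to\Sigma$; let $\bar f(x)=x\circ f(x)$ be the string $x$ with the symbol $f(x)$ appended. For $T\ge 1$, let $f^{\mathsf{CoT},T}(x)\in\Sigma^T$ be the suffix of length $T$ of the $T$-fold iterate $\bar f^{\,T}(x)$, and let $f^{\mathsf{e2e},T}(x)\in\Sigma$ be its last symbol. For a class $\mathcal F$ of next-token generators put $\mathcal F^{\mathsf{CoT},T}=\{f^{\mathsf{CoT},T}:f\in\mathcal F\}$. Let $\mathrm{VC}(\mathcal F)\in\mathbb N\cup\{\infty\}$ be the VC dimension of $\mathcal F$ and let $\mathrm{VC}^\star(\mathcal F)$ be the dual VC dimension, that is, the VC dimension of the class $\{f\mapsto f(x): x\in\Sigma^\star\}$ of functions on $\mathcal F$. A class $\mathcal H$ of functions $\mathcal X\to\mathcal Y$ is learnable with sample complexity $m(\epsilon,\delta)\in\mathbb N$ if there is a single (deterministic) learning rule, mapping finite sequences of examples in $\mathcal X\times\mathcal Y$ to predictors $\mathcal X\to\mathcal Y$, such that for every distribution $D$ on $\mathcal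 X$, all $\epsilon,\delta>0$ and every target $f_\star\in\mathcal H$, when the rule is given $m(\epsilon,\delta)$ i.i.d. points from $D$ labelled by $f_\star$, it outputs with probability at least $1-\delta$ a predictor $h$ with $\Pr_{x\sim D}[h(x)\ne f_\star(x)]\le\epsilon$. The class is learnable if this holds for some function $m$. The class $\mathcal F$ with generation length $T$ is learnable under chain-of-thought supervision with sample complexity $m$ if the same holds with target $f_\star\in\mathcal F$, training labels $f_\star^{\mathsf{CoT},T}(x_i)$, predictors $h:\Sigma^\star\to\Sigma$, and error $\Pr_{x\sim D}[h(x)\ne f_\star^{\mathsf{e2e},T}(x)]$. **Theorem.** There is a universal constant $C>0$ such that the following holds for every class $\mathcal F$ of binary next-token generators with $\mathrm{VC}(\mathcal F)<\infty$. The dual VC dimension $\mathrm{VC}^\star(\mathcal F)$ is finite, and, with $k=\mathrm{VC}(\mathcal F)\cdot\mathrm{VC}^\star(\mathcal F)$, for every $T\ge 1$ the class $\mathcal F^{\mathsf{CoT},T}$ is learnable with sample complexity $$m(\epsilon,\delta)=\left\lceil C\cdot\frac{k\,\log(k+2)\,\log(2/\epsilon)+\log(1/\delta)}{\epsilon}\right\rceil=\tilde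 O\!\left(\frac{\mathrm{VC}(\mathcal F)\,\mathrm{VC}^\star(\mathcal F)+\log(1/\delta)}{\epsilon}\right)$$ (read as $0$ when the expression is negative, which can happen only if $\epsilon\geq 1$ or $\delta\geq 1$), and $\mathcal F$ with generation length $T$ is learnable under chain-of-thought supervision with the same sample complexity. This bound does not depend on $T$. Conversely, if $\mathrm{VC}(\mathcal F)=\infty$, then for every $T\ge 1$ the class $\mathcal F^{\mathsf{CoT},T}$ is not learnable. -/

import Mathlib

open MeasureTheory

namespace Autoregressive

/-! Binary classes: shattering, VC dimension, dual VC dimension. -/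

/-- A finite set `S` is shattered by `F` if every binary labelling of `S` is realized by `F`. -/
def Shatters {X : Type*} (F : Set (X → Bool)) (S : Finset X) : Prop :=
  ∀ y : X → Bool, ∃ f ∈ F, ∀ x ∈ S, f x = y x

/-- The VC dimension: the supremum of the sizes of shattered finite sets (`⊤` if unbounded). -/
noncomputable def vcDim {X : Type*} (F : Set (X → Bool)) : ℕ∞ :=
  ⨆ (S : Finset X) (_ : Shatters F S), (S.card : ℕ∞)

/-- The dual class: the functions `f ↦ f x` on `F`, for `x : X`. -/
def dualClass {X : Type*} (F : Set (X → Bool)) : Set (F → Bool) :=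
  Set.range fun (x : X) (f : F) => f.1 x

/-- The dual VC dimension. -/
noncomputable def dualVcDim {X : Type*} (F : Set (X → Bool)) : ℕ∞ :=
  vcDim (dualClass F)

/-! Autoregressive generation over the alphabet `Bool`; strings are lists, and new symbols are
appended at the end. -/

/-- The apply-and-append map `x ↦ x ∘ f(x)` of a next-token generator. -/
def applyAppend (f : List Bool → Bool) (x : List Bool) : List Bool :=
  x ++ [f x]

theorem length_iterate_applyAppend (f : List Bool → Bool) (T : ℕ) (x : List Bool) :
    ((applyAppend f)^[T] x).length = x.length + T := by
  induction T generalizing x with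
  | zero => rfl
  | succ T ih =>
    rw [Function.iterate_succ_apply, ih]
    simp only [applyAppend, List.length_append, List.length_singleton]
    omega

/-- The `T`-step chain of thought of `f` on `x`: the last `T` symbols of the `T`-fold iterate of
the apply-and-append map at `x`, that is, those following the initial `x`. -/
def cot (f : List Bool → Bool) (T : ℕ) (x : List Bool) : Fin T → Bool := fun i =>
  ((applyAppend f)^[T] x)[x.length + i.1]'(by
    rw [length_iterate_applyAppend]; exact Nat.add_lt_add_left i.2 _)

/-- The end-to-end output: the last symbol of the chain of thought. -/
def e2e (f : List Bool → Bool) (T : ℕ) (hT : 1 ≤ T) (x : List Bool) : Bool :=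
  cot f T x ⟨T - 1, Nat.sub_lt hT Nat.one_pos⟩

/-- The class of chain-of-thought maps induced by a base class. -/
def cotClass (F : Set (List Bool → Bool)) (T : ℕ) : Set (List Bool → Fin T → Bool) :=
  (fun f => cot f T) '' F

/-! PAC learning. -/

/-- The sample `((x₁, f x₁), …, (xₙ, f xₙ))`. -/
def labeledSample {X Y : Type*} {n : ℕ} (f : X → Y) (x : Fin n → X) : List (X × Y) :=
  List.ofFn fun i => (x i, f (x i))

/-- The population loss of the predictor `h` with respect to the target `f`. -/
noncomputable def loss {X Y : Type*} [MeasurableSpace X] (D : Measure X) (f h : X → Y) : ℝ :=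
  D.real {x | h x ≠ f x}

/-- `H` is PAC learnable (in the realizable case) with sample complexity `m`: one learning rule
has, for every distribution, accuracy, confidence and target in `H`, loss above `ε` with
probability at most `δ` on an i.i.d. labeled sample of size `m ε δ`. -/
def LearnableWith {X Y : Type*} [MeasurableSpace X] (H : Set (X → Y)) (m : ℝ → ℝ → ℕ) : Prop :=
  ∃ Lrn : List (X × Y) → X → Y,
    ∀ D : Measure X, IsProbabilityMeasure D → ∀ ε δ : ℝ, 0 < ε → 0 < δ → ∀ f ∈ H,
      (Measure.pi fun _ : Fin (m ε δ) => D).real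
        {x | ε < loss D f (Lrn (labeledSample f x))} ≤ δ

/-- `H` is PAC learnable: it is so with some finite sample complexity. -/
def Learnable {X Y : Type*} [MeasurableSpace X] (H : Set (X → Y)) : Prop :=
  ∃ m : ℝ → ℝ → ℕ, LearnableWith H m

/-- The set of all strings is countable; every set of strings is an event. -/
instance instMeasurableSpaceString : MeasurableSpace (List Bool) := ⊤

instance instDiscreteMeasurableSpaceString : DiscreteMeasurableSpace (List Bool) :=
  ⟨fun _ => trivial⟩

/-- `F` with generation length `T` is learnable under chain-of-thought supervision with sample
complexity `m`: the training labels are full chains of thought, and the predictor is tested on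
the final symbol only. -/
def CoTLearnableWith (F : Set (List Bool → Bool)) (T : ℕ) (hT : 1 ≤ T) (m : ℝ → ℝ → ℕ) : Prop :=
  ∃ Lrn : List (List Bool × (Fin T → Bool)) → List Bool → Bool,
    ∀ D : Measure (List Bool), IsProbabilityMeasure D → ∀ ε δ : ℝ, 0 < ε → 0 < δ → ∀ f ∈ F,
      (Measure.pi fun _ : Fin (m ε δ) => D).real
        {x | ε < loss D (e2e f T hT) (Lrn (labeledSample (cot f T) x))} ≤ δ

/-- The sample size `⌈C (k log(k + 2) log(2/ε) + log(1/δ)) / ε⌉`. -/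
noncomputable def sampleSize (C : ℝ) (k : ℕ) (ε δ : ℝ) : ℕ :=
  ⌈C * ((k : ℝ) * Real.log ((k : ℝ) + 2) * Real.log (2 / ε) + Real.log (1 / δ)) / ε⌉₊

end Autoregressive

/-! The generation length disappears because of `cot_eq_iff`: any function, in `F` or not, has the
same chain of thought as `f` on `x` exactly when it agrees with `f` on the `T` prefixes that `f`
itself reads. Thus `n` labelled chains amount to `n * T` binary examples of `f`, and VC arguments on
this finite set give bounds independent of its size.

The learner is a sample compression scheme (`exists_compression`). For any weights on the prefixes,
`1008 * d` weighted draws can be a uniform `1/6`-approximation for the error sets of members of `F`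
(`exists_approximation`), so a member fitted to the chains drawn has weighted error at most `1/6`.
By minimax (`exists_mixed_response`) some mixture of fitted members errs with weight at most `1/6`
at every prefix. Each prefix is a function on `F`, so the same approximation in the dual class
replaces the mixture by `1008 * d'` members. At every prefix fewer than half of them err, so their
majority vote reproduces all the chains. It depends on only `1008 * 1008 * (d * d')` examples.

Generalization is a union bound over the possible subsamples (`pi_compressionLearner_le`), and
`sampleSize_spec` solves the resulting inequality for `n`. If a dimension is zero, one example
identifies the target. The dual dimension is finite by Assouad's argument.

For the converse, `n` chains carry at most `n * T` bits of labels. On a shattered set larger than a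
multiple of this, too few predictors are available to approximate most labellings. -/

namespace Autoregressive

/-! Uniform approximation by small samples for weighted finite set families. -/

section Approximation

variable {α : Type*} [DecidableEq α]

/-- The real-valued indicator of a finite set. -/
noncomputable def indic (A : Finset α) (a : α) : ℝ := if a ∈ A then 1 else 0

theorem indic_mem_unit (A : Finset α) (a : α) : 0 ≤ indic A a ∧ indic A a ≤ 1 := by
  unfold indic; split_ifs <;> norm_num

/-- Sauer–Shelah by way of Pajor's inequality: a family has at most as many members as it shatters
sets, and a set shattered by the traces lies in `U` and is shattered by `𝒜`. -/
theorem card_traces_le (𝒜 : Finset (Finset α)) {d n : ℕ}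
    (h𝒜 : ∀ s, 𝒜.Shatters s → s.card ≤ d) {U : Finset α} (hU : U.card ≤ n) :
    (𝒜.image (U ∩ ·)).card ≤ ∑ i ∈ Finset.range (d + 1), n.choose i := by
  refine (Finset.card_le_card_shatterer _).trans ?_
  have hsub : (𝒜.image (U ∩ ·)).shatterer ⊆
      (Finset.range (d + 1)).biUnion fun i => U.powersetCard i := by
    intro s hs
    rw [Finset.mem_shatterer] at hs
    have hsU : s ⊆ U := by
      obtain ⟨t, ht, hst⟩ := hs.exists_superset
      obtain ⟨A, -, rfl⟩ := Finset.mem_image.1 ht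
      exact hst.trans Finset.inter_subset_left
    have hs' : 𝒜.Shatters s := by
      intro t ht
      obtain ⟨u, hu, hut⟩ := hs ht
      obtain ⟨A, hA, rfl⟩ := Finset.mem_image.1 hu
      refine ⟨A, hA, ?_⟩
      rw [← hut, ← Finset.inter_assoc, Finset.inter_eq_left.2 hsU]
    simp only [Finset.mem_biUnion, Finset.mem_range, Finset.mem_powersetCard]
    exact ⟨s.card, Nat.lt_succ_of_le (h𝒜 s hs'), hsU, rfl⟩
  refine (Finset.card_le_card hsub).trans (Finset.card_biUnion_le.trans ?_)
  refine Finset.sum_le_sum fun i _ => ?_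
  rw [Finset.card_powersetCard]
  exact Nat.choose_le_choose i hU

/-- Since `t ^ d ≤ t ^ i` for `i ≤ d`, the left side is at most a partial sum of the binomial
expansion. -/
theorem sum_choose_mul_pow_le (n d : ℕ) {t : ℝ} (h0 : 0 ≤ t) (h1 : t ≤ 1) :
    (∑ i ∈ Finset.range (d + 1), (n.choose i : ℝ)) * t ^ d ≤ (1 + t) ^ n := by
  have key : ∑ i ∈ Finset.range (d + 1), (n.choose i : ℝ) * t ^ i ≤ (1 + t) ^ n := by
    rw [add_comm 1 t, add_pow]
    have h2 : ∑ i ∈ Finset.range (n + 1), t ^ i * 1 ^ (n - i) * (n.choose i : ℝ) =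
        ∑ i ∈ Finset.range (n + 1 + (d + 1)), (n.choose i : ℝ) * t ^ i := by
      rw [eq_comm, Finset.sum_range_add _ (n + 1) (d + 1)]
      have h3 : ∑ i ∈ Finset.range (d + 1), (n.choose (n + 1 + i) : ℝ) * t ^ (n + 1 + i) = 0 := by
        refine Finset.sum_eq_zero fun i _ => ?_
        rw [Nat.choose_eq_zero_of_lt (by omega)]; simp
      rw [h3, add_zero]
      exact Finset.sum_congr rfl fun i _ => by rw [one_pow, mul_one, mul_comm]
    rw [h2]
    refine Finset.sum_le_sum_of_subset_of_nonneg ?_ fun i _ _ => by positivity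
    exact Finset.range_mono (by omega)
  refine le_trans ?_ key
  rw [Finset.sum_mul]
  refine Finset.sum_le_sum fun i hi => ?_
  refine mul_le_mul_of_nonneg_left ?_ (by positivity)
  exact pow_le_pow_of_le_one h0 h1 (Nat.lt_succ_iff.1 (Finset.mem_range.1 hi))

/-- This fixes the constant 1008. With `m = 1008 * d` the target is `exp (14 * d)`. Taking `t =
1/288` gives `(1 + t) ^ (2 * m) ≤ exp (7 * d)`, and the remaining `2 * 288 ^ d ≤ 576 ^ d` is below
`exp (7 * d)`. -/
theorem two_mul_sum_choose_lt_exp {d : ℕ} (hd : 1 ≤ d) :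
    2 * (∑ i ∈ Finset.range (d + 1), ((2 * (1008 * d)).choose i : ℝ)) <
      Real.exp ((1008 * d : ℕ) / 72) := by
  have h := sum_choose_mul_pow_le (2 * (1008 * d)) d (t := 1 / 288) (by norm_num) (by norm_num)
  have h1 : (1 + 1 / 288 : ℝ) ^ (2 * (1008 * d)) ≤ Real.exp 7 ^ d := by
    have : (1 + 1 / 288 : ℝ) ≤ Real.exp (1 / 288) := by
      have := Real.add_one_le_exp (1 / 288 : ℝ); linarith
    calc (1 + 1 / 288 : ℝ) ^ (2 * (1008 * d)) ≤ Real.exp (1 / 288) ^ (2 * (1008 * d)) := by gcongr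
      _ = Real.exp 7 ^ d := by
        rw [← Real.exp_nat_mul, ← Real.exp_nat_mul]; congr 1; push_cast; ring
  have h2 : Real.exp ((1008 * d : ℕ) / 72) = Real.exp 7 ^ d * Real.exp 7 ^ d := by
    rw [← Real.exp_nat_mul, ← Real.exp_add]; congr 1; push_cast; ring
  have h3 : (576 : ℝ) < Real.exp 7 := by
    have h4 : Real.exp 7 = Real.exp 1 ^ 7 := by rw [← Real.exp_nat_mul]; norm_num
    have h5 : (2.7 : ℝ) < Real.exp 1 := by have := Real.exp_one_gt_d9; linarith
    rw [h4]
    calc (576 : ℝ) < 2.7 ^ 7 := by norm_num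
      _ < Real.exp 1 ^ 7 := by gcongr
  have h6 : 2 * (288 : ℝ) ^ d ≤ 576 ^ d := by
    have : (576 : ℝ) ^ d = 2 ^ d * 288 ^ d := by rw [← mul_pow]; norm_num
    rw [this]
    gcongr
    calc (2 : ℝ) = 2 ^ 1 := by norm_num
      _ ≤ 2 ^ d := by gcongr; norm_num
  have h7 : (576 : ℝ) ^ d < Real.exp 7 ^ d := by
    gcongr
  rw [one_div, inv_pow, ← div_eq_mul_inv, div_le_iff₀ (by positivity)] at h
  rw [h2]
  set Φ := ∑ i ∈ Finset.range (d + 1), ((2 * (1008 * d)).choose i : ℝ)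
  have hE : 0 < Real.exp 7 ^ d := by positivity
  calc 2 * Φ ≤ 2 * ((1 + (288 : ℝ)⁻¹) ^ (2 * (1008 * d)) * 288 ^ d) := by gcongr
    _ ≤ 2 * (Real.exp 7 ^ d * 288 ^ d) := by rw [one_div] at h1; gcongr
    _ = Real.exp 7 ^ d * (2 * 288 ^ d) := by ring
    _ < Real.exp 7 ^ d * Real.exp 7 ^ d := by
      apply mul_lt_mul_of_pos_left _ hE; linarith

/-- The difference of the counts of `A` in the two halves of a double sample. -/
noncomputable def countDiff {m : ℕ} (A : Finset α) (z : Fin m → α × α) : ℝ :=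
  ∑ i, (indic A (z i).1 - indic A (z i).2)

/-- The points of a double sample. -/
def support {m : ℕ} (z : Fin m → α × α) : Finset α :=
  Finset.univ.biUnion fun i => {(z i).1, (z i).2}

theorem card_support_le {m : ℕ} (z : Fin m → α × α) : (support z).card ≤ 2 * m := by
  refine Finset.card_biUnion_le.trans ((Finset.sum_le_card_nsmul _ _ 2 fun i _ => ?_).trans ?_)
  · exact Finset.card_le_two
  · simp [mul_comm]

/-- Swap the two entries of a double sample at the indices selected by `σ`. -/
def swapAt {m : ℕ} (σ : Fin m → Bool) (z : Fin m → α × α) : Fin m → α × α :=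
  fun i => if σ i then (z i).swap else z i

omit [DecidableEq α] in
theorem swapAt_involutive {m : ℕ} (σ : Fin m → Bool) :
    Function.Involutive (swapAt (α := α) σ) := by
  intro z; funext i; unfold swapAt; cases σ i <;> simp

theorem support_swapAt {m : ℕ} (σ : Fin m → Bool) (z : Fin m → α × α) :
    support (swapAt σ z) = support z := by
  unfold support
  refine Finset.biUnion_congr rfl fun i _ => ?_
  unfold swapAt
  cases σ i
  · simp
  · simp [Finset.pair_comm]

/-- Only traces on the double sample matter, so the number of sets to control is bounded by
`card_traces_le`. -/
theorem countDiff_inter_support {m : ℕ} (A : Finset α) (z : Fin m → α × α) :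
    countDiff (support z ∩ A) z = countDiff A z := by
  unfold countDiff
  refine Finset.sum_congr rfl fun i _ => ?_
  have h1 : (z i).1 ∈ support z := Finset.mem_biUnion.2 ⟨i, Finset.mem_univ _, by simp⟩
  have h2 : (z i).2 ∈ support z := Finset.mem_biUnion.2 ⟨i, Finset.mem_univ _, by simp⟩
  simp [indic, h1, h2]

/-- Random swapping makes the exponential moments of the count difference subgaussian. -/
theorem sum_exp_countDiff_swapAt_le {m : ℕ} (A : Finset α) (z : Fin m → α × α) {c : ℝ}
    (hc : c ^ 2 = 1 / 36) :
    ∑ σ : Fin m → Bool, Real.exp (c * countDiff A (swapAt σ z)) ≤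
      2 ^ m * Real.exp (m / 72) := by
  have h1 : ∀ σ : Fin m → Bool, Real.exp (c * countDiff A (swapAt σ z)) =
      ∏ i, Real.exp ((if σ i then -1 else 1) * (c * (indic A (z i).1 - indic A (z i).2))) := by
    intro σ
    rw [← Real.exp_sum, countDiff, Finset.mul_sum]
    congr 1
    refine Finset.sum_congr rfl fun i _ => ?_
    unfold swapAt
    cases σ i
    · simp
    · simp only [if_true, Prod.fst_swap, Prod.snd_swap]; ring
  simp_rw [h1]
  rw [← Fintype.piFinset_univ, Finset.sum_prod_piFinset (κ := Bool) Finset.univ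
    fun i b => Real.exp ((if b then -1 else 1) * (c * (indic A (z i).1 - indic A (z i).2)))]
  have h2 : (2 : ℝ) ^ m * Real.exp (m / 72) = ∏ _i : Fin m, (2 * Real.exp (1 / 72)) := by
    rw [Finset.prod_const, Finset.card_univ, Fintype.card_fin, mul_pow, ← Real.exp_nat_mul]
    congr 2; ring
  rw [h2]
  refine Finset.prod_le_prod (fun i _ => Finset.sum_nonneg fun b _ => (Real.exp_pos _).le)
    fun i _ => ?_
  rw [Fintype.sum_bool]
  set y := c * (indic A (z i).1 - indic A (z i).2) with hy
  have hy2 : y ^ 2 ≤ 1 / 36 := by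
    have h3 := indic_mem_unit A (z i).1
    have h4 := indic_mem_unit A (z i).2
    have h5 : (indic A (z i).1 - indic A (z i).2) ^ 2 ≤ 1 := by
      rw [sq_le_one_iff_abs_le_one, abs_le]; constructor <;> linarith
    rw [hy, mul_pow, hc]; linarith
  have hcosh := Real.cosh_le_exp_half_sq y
  rw [Real.cosh_eq] at hcosh
  have h6 : Real.exp (y ^ 2 / 2) ≤ Real.exp (1 / 72) := Real.exp_le_exp.2 (by linarith)
  simp only [if_true, Bool.false_eq_true, if_false, neg_mul, one_mul]
  linarith

variable [Fintype α]

omit [DecidableEq α] in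
theorem sum_prod_weights_mul {m : ℕ} (w : α → ℝ) (g : Fin m → α → ℝ) :
    ∑ x : Fin m → α, (∏ i, w (x i)) * ∏ i, g i (x i) = ∏ i, ∑ a, w a * g i a := by
  simp_rw [← Finset.prod_mul_distrib]
  rw [← Fintype.piFinset_univ, Finset.sum_prod_piFinset Finset.univ fun i a => w a * g i a]

/-- Jensen's inequality for replacing the mean by an independent second sample. -/
theorem exp_le_sum_exp_countDiff {m : ℕ} (w : α → ℝ) (hw : ∀ a, 0 ≤ w a) (hw1 : ∑ a, w a = 1)
    (A : Finset α) (x : Fin m → α) (c : ℝ) :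
    Real.exp (c * (∑ i, indic A (x i) - m * ∑ a, w a * indic A a)) ≤
      ∑ y : Fin m → α, (∏ i, w (y i)) *
        Real.exp (c * countDiff A fun i => (x i, y i)) := by
  have h1 : ∀ y : Fin m → α, Real.exp (c * countDiff A fun i => (x i, y i)) =
      ∏ i, Real.exp (c * (indic A (x i) - indic A (y i))) := by
    intro y; rw [← Real.exp_sum, countDiff, Finset.mul_sum]
  simp_rw [h1]
  rw [sum_prod_weights_mul w fun i a => Real.exp (c * (indic A (x i) - indic A a))]
  have h2 : c * (∑ i, indic A (x i) - m * ∑ a, w a * indic A a) =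
      ∑ i, c * (indic A (x i) - ∑ a, w a * indic A a) := by
    rw [← Finset.mul_sum, Finset.sum_sub_distrib]; simp
  rw [h2, Real.exp_sum]
  refine Finset.prod_le_prod (fun i _ => (Real.exp_pos _).le) fun i _ => ?_
  have h3 := convexOn_exp.map_sum_le (t := Finset.univ) (w := w)
    (p := fun a => c * (indic A (x i) - indic A a)) (fun a _ => hw a) hw1 (fun _ _ => trivial)
  simp only [smul_eq_mul] at h3
  refine le_trans (le_of_eq ?_) h3
  congr 1
  have h4 : ∀ a, w a * (c * (indic A (x i) - indic A a)) =
      w a * (c * indic A (x i)) - c * (w a * indic A a) := fun a => by ring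
  simp_rw [h4]
  rw [Finset.sum_sub_distrib, ← Finset.sum_mul, hw1, ← Finset.mul_sum]; ring

/-- The total exponential moment of the traces of a family on a double sample. -/
noncomputable def traceMoment {m : ℕ} (𝒜 : Finset (Finset α)) (z : Fin m → α × α) : ℝ :=
  ∑ B ∈ 𝒜.image (support z ∩ ·),
    (Real.exp (1 / 6 * countDiff B z) + Real.exp (-(1 / 6) * countDiff B z))

-- Swapping preserves the support, hence the set of traces, so the two sums can be exchanged and
-- each trace treated separately.
omit [Fintype α] in
theorem sum_traceMoment_swapAt_le {m d : ℕ} (𝒜 : Finset (Finset α))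
    (h𝒜 : ∀ s, 𝒜.Shatters s → s.card ≤ d) (z : Fin m → α × α) :
    ∑ σ : Fin m → Bool, traceMoment 𝒜 (swapAt σ z) ≤
      2 ^ m * (2 * (∑ i ∈ Finset.range (d + 1), ((2 * m).choose i : ℝ)) * Real.exp (m / 72)) := by
  unfold traceMoment
  simp_rw [support_swapAt]
  rw [Finset.sum_comm]
  have hB : ∀ B ∈ 𝒜.image (support z ∩ ·), ∑ σ : Fin m → Bool,
      (Real.exp (1 / 6 * countDiff B (swapAt σ z)) +
        Real.exp (-(1 / 6) * countDiff B (swapAt σ z))) ≤ 2 * (2 ^ m * Real.exp (m / 72)) := by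
    intro B _
    rw [Finset.sum_add_distrib, two_mul]
    exact add_le_add (sum_exp_countDiff_swapAt_le B z (by norm_num))
      (sum_exp_countDiff_swapAt_le B z (by norm_num))
  refine (Finset.sum_le_card_nsmul _ _ _ hB).trans ?_
  rw [nsmul_eq_mul]
  have hcard : ((𝒜.image (support z ∩ ·)).card : ℝ) ≤
      ∑ i ∈ Finset.range (d + 1), ((2 * m).choose i : ℝ) := by
    exact_mod_cast card_traces_le 𝒜 h𝒜 (card_support_le z)
  calc _ ≤ (∑ i ∈ Finset.range (d + 1), ((2 * m).choose i : ℝ)) *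
        (2 * (2 ^ m * Real.exp (m / 72))) := by gcongr
    _ = _ := by ring

/-- The product weight is invariant under swaps, so the expectation is unchanged by averaging over
all of them. -/
theorem sum_weights_mul_traceMoment_le {m d : ℕ} (w : α → ℝ) (hw : ∀ a, 0 ≤ w a)
    (hw1 : ∑ a, w a = 1) (𝒜 : Finset (Finset α)) (h𝒜 : ∀ s, 𝒜.Shatters s → s.card ≤ d) :
    ∑ z : Fin m → α × α, (∏ i, w (z i).1 * w (z i).2) * traceMoment 𝒜 z ≤
      2 * (∑ i ∈ Finset.range (d + 1), ((2 * m).choose i : ℝ)) * Real.exp (m / 72) := by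
  set W : (Fin m → α × α) → ℝ := fun z => ∏ i, w (z i).1 * w (z i).2 with hW
  set b := 2 * (∑ i ∈ Finset.range (d + 1), ((2 * m).choose i : ℝ)) * Real.exp (m / 72)
  have hWswap : ∀ σ z, W (swapAt σ z) = W z := by
    intro σ z
    refine Finset.prod_congr rfl fun i _ => ?_
    unfold swapAt
    cases σ i
    · simp
    · simp [mul_comm]
  have hW1 : ∑ z, W z = 1 := by
    rw [hW, ← Fintype.piFinset_univ,
      Finset.sum_prod_piFinset Finset.univ fun (_ : Fin m) (p : α × α) => w p.1 * w p.2]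
    refine Finset.prod_eq_one fun i _ => ?_
    rw [Fintype.sum_prod_type]
    simp_rw [← Finset.mul_sum, hw1, mul_one, hw1]
  have hswap : ∀ σ : Fin m → Bool,
      ∑ z, W z * traceMoment 𝒜 (swapAt σ z) = ∑ z, W z * traceMoment 𝒜 z := by
    intro σ
    rw [← Equiv.sum_comp (swapAt_involutive σ).toPerm (fun z => W z * traceMoment 𝒜 z)]
    refine Finset.sum_congr rfl fun z _ => ?_
    simp [hWswap]
  have h2 : 2 ^ m * ∑ z, W z * traceMoment 𝒜 z ≤ 2 ^ m * b := by
    calc 2 ^ m * ∑ z, W z * traceMoment 𝒜 z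
        = ∑ σ : Fin m → Bool, ∑ z, W z * traceMoment 𝒜 (swapAt σ z) := by
          simp_rw [hswap]; simp
      _ = ∑ z, W z * ∑ σ : Fin m → Bool, traceMoment 𝒜 (swapAt σ z) := by
          rw [Finset.sum_comm]; simp_rw [Finset.mul_sum]
      _ ≤ ∑ z, W z * (2 ^ m * b) := by
          refine Finset.sum_le_sum fun z _ => mul_le_mul_of_nonneg_left
            (sum_traceMoment_swapAt_le 𝒜 h𝒜 z) ?_
          exact Finset.prod_nonneg fun i _ => mul_nonneg (hw _) (hw _)
      _ = 2 ^ m * b := by rw [← Finset.sum_mul, hW1, one_mul]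
  exact le_of_mul_le_mul_left h2 (by positivity)

/-- A family of VC dimension at most `d` on a finite probability space has a uniform
`1/6`-approximation of size linear in `d`. -/
theorem exists_approximation (w : α → ℝ) (hw : ∀ a, 0 ≤ w a) (hw1 : ∑ a, w a = 1)
    (𝒜 : Finset (Finset α)) {d : ℕ} (hd : 1 ≤ d) (h𝒜 : ∀ s, 𝒜.Shatters s → s.card ≤ d) :
    ∃ x : Fin (1008 * d) → α, ∀ A ∈ 𝒜,
      |∑ i, indic A (x i) - (1008 * d : ℕ) * ∑ a, w a * indic A a| ≤ (1008 * d : ℕ) / 6 := by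
  set m := 1008 * d with hm
  by_contra! hcon
  -- If every sample `x` has a set deviating by more than `m / 6`, exponential rate `1/6` yields a
  -- moment of at least `exp (m / 36)`. Both signs of the rate are kept because the deviation may
  -- have either sign.
  have hlow : ∀ x : Fin m → α, Real.exp (m / 36) ≤
      ∑ y : Fin m → α, (∏ i, w (y i)) * traceMoment 𝒜 fun i => (x i, y i) := by
    intro x
    obtain ⟨A, hA, hbad⟩ := hcon x
    have hterm : ∀ y : Fin m → α,
        Real.exp (1 / 6 * countDiff A fun i => (x i, y i)) +
          Real.exp (-(1 / 6) * countDiff A fun i => (x i, y i)) ≤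
        traceMoment 𝒜 fun i => (x i, y i) := by
      intro y
      rw [← countDiff_inter_support A]
      exact Finset.single_le_sum (f := fun B =>
        Real.exp (1 / 6 * countDiff B fun i => (x i, y i)) +
          Real.exp (-(1 / 6) * countDiff B fun i => (x i, y i)))
        (fun B _ => by positivity) (Finset.mem_image_of_mem _ hA)
    have hsum : Real.exp (1 / 6 * (∑ i, indic A (x i) - m * ∑ a, w a * indic A a)) +
        Real.exp (-(1 / 6) * (∑ i, indic A (x i) - m * ∑ a, w a * indic A a)) ≤
        ∑ y : Fin m → α, (∏ i, w (y i)) * traceMoment 𝒜 fun i => (x i, y i) := by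
      refine (add_le_add (exp_le_sum_exp_countDiff w hw hw1 A x _)
        (exp_le_sum_exp_countDiff w hw hw1 A x _)).trans ?_
      rw [← Finset.sum_add_distrib]
      refine Finset.sum_le_sum fun y _ => ?_
      rw [← mul_add]
      exact mul_le_mul_of_nonneg_left (hterm y) (Finset.prod_nonneg fun i _ => hw _)
    refine le_trans ?_ hsum
    rcases lt_abs.1 hbad with h | h
    · refine le_trans (Real.exp_le_exp.2 ?_) (le_add_of_nonneg_right (Real.exp_pos _).le)
      linarith
    · refine le_trans (Real.exp_le_exp.2 ?_) (le_add_of_nonneg_left (Real.exp_pos _).le)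
      linarith
  have hW1 : ∑ x : Fin m → α, ∏ i, w (x i) = 1 := by
    have := sum_prod_weights_mul (m := m) w fun _ _ => 1
    simpa [hw1] using this
  have hup := sum_weights_mul_traceMoment_le (m := m) w hw hw1 𝒜 h𝒜
  have hsplit : ∑ z : Fin m → α × α, (∏ i, w (z i).1 * w (z i).2) * traceMoment 𝒜 z =
      ∑ x : Fin m → α, (∏ i, w (x i)) *
        ∑ y : Fin m → α, (∏ i, w (y i)) * traceMoment 𝒜 fun i => (x i, y i) := by
    rw [← Equiv.sum_comp (Equiv.arrowProdEquivProdArrow (Fin m) (fun _ => α) fun _ => α).symm,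
      Fintype.sum_prod_type]
    refine Finset.sum_congr rfl fun x _ => ?_
    rw [Finset.mul_sum]
    refine Finset.sum_congr rfl fun y _ => ?_
    rw [← mul_assoc, ← Finset.prod_mul_distrib]
    rfl
  have hlow' : Real.exp (m / 36) ≤
      ∑ z : Fin m → α × α, (∏ i, w (z i).1 * w (z i).2) * traceMoment 𝒜 z := by
    rw [hsplit]
    calc Real.exp (m / 36) = ∑ x : Fin m → α, (∏ i, w (x i)) * Real.exp (m / 36) := by
          rw [← Finset.sum_mul, hW1, one_mul]
      _ ≤ _ := Finset.sum_le_sum fun x _ =>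
          mul_le_mul_of_nonneg_left (hlow x) (Finset.prod_nonneg fun i _ => hw _)
  have hnum := two_mul_sum_choose_lt_exp hd
  rw [← hm] at hnum
  have h36 : Real.exp ((m : ℝ) / 36) = Real.exp (m / 72) * Real.exp (m / 72) := by
    rw [← Real.exp_add]; congr 1; ring
  have := mul_lt_mul_of_pos_right hnum (Real.exp_pos ((m : ℝ) / 72))
  linarith

end Approximation

/-- The minimax theorem for finite matrix games: if every mixed strategy of the row player has
a response with value at most `v`, some mixed response has value at most `v` on every row. -/
theorem exists_mixed_response {ι κ : Type*} [Fintype ι] [Fintype κ] [Nonempty ι]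
    (M : ι → κ → ℝ) (v : ℝ)
    (h : ∀ p : ι → ℝ, (∀ i, 0 ≤ p i) → ∑ i, p i = 1 → ∃ j, ∑ i, p i * M i j ≤ v) :
    ∃ q : κ → ℝ, (∀ j, 0 ≤ q j) ∧ ∑ j, q j = 1 ∧ ∀ i, ∑ j, q j * M i j ≤ v := by
  classical
  by_contra! hcon
  set s : Set (ι → ℝ) := (fun q : κ → ℝ => fun i => ∑ j, q j * M i j) '' stdSimplex ℝ κ with hs
  set t : Set (ι → ℝ) := Set.Iic fun _ => v with ht
  have hlin : (fun q : κ → ℝ => fun i => ∑ j, q j * M i j) = (Matrix.of M).mulVecLin := by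
    funext q i
    simp [Matrix.mulVec, dotProduct, mul_comm]
  have hs1 : Convex ℝ s := by
    rw [hs, hlin]; exact (convex_stdSimplex ℝ κ).linear_image _
  have hs2 : IsCompact s := (isCompact_stdSimplex ℝ κ).image (by fun_prop)
  have hdisj : Disjoint s t := by
    rw [Set.disjoint_left]
    rintro _ ⟨q, ⟨hq0, hq1⟩, rfl⟩ hle
    obtain ⟨i, hi⟩ := hcon q hq0 hq1
    exact absurd (hle i) (not_le.2 hi)
  obtain ⟨f, a, b, hfa, hab, hfb⟩ :=
    geometric_hahn_banach_compact_closed hs1 hs2 (convex_Iic _) isClosed_Iic hdisj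
  set e : ι → ι → ℝ := fun i => Pi.single i 1 with he
  have hf : ∀ z : ι → ℝ, f z = ∑ i, z i * f (e i) := by
    intro z
    conv_lhs => rw [← Finset.univ_sum_single z]
    rw [map_sum]
    refine Finset.sum_congr rfl fun i _ => ?_
    have : Pi.single i (z i) = z i • e i := by
      simp [he, ← Pi.single_smul]
    rw [this, map_smul, smul_eq_mul]
  -- The set `t` is unbounded in the direction `-e i` and `f` is bounded below on it, so no
  -- coefficient can be positive. The negated, normalized coefficients will be a mixed strategy
  -- contradicting `h`.
  have hneg : ∀ i, f (e i) ≤ 0 := by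
    intro i
    by_contra! hpos
    have hmem : ∀ r : ℝ, 0 ≤ r → b < f (fun _ => v) - r * f (e i) := by
      intro r hr
      have := hfb ((fun _ => v) - r • e i) (by
        intro j
        simp only [Pi.sub_apply, Pi.smul_apply, smul_eq_mul]
        have : 0 ≤ e i j := by
          simp only [he, Pi.single_apply]; split_ifs <;> norm_num
        nlinarith)
      simpa using this
    have h0 := hmem 0 le_rfl
    have h1 := hmem ((f (fun _ => v) - b) / f (e i)) (div_nonneg (by linarith) hpos.le)
    rw [div_mul_cancel₀ _ hpos.ne'] at h1
    linarith
  set c := ∑ i, -f (e i) with hc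
  have hκ : ∀ j, ∑ i, M i j * f (e i) < a := by
    intro j
    have := hfa _ ⟨Pi.single j 1, single_mem_stdSimplex ℝ j, rfl⟩
    rw [hf] at this
    simpa [Pi.single_apply] using this
  have hv : b < v * ∑ i, f (e i) := by
    have := hfb (fun _ => v) (le_refl (fun _ : ι => v))
    rwa [hf, ← Finset.mul_sum] at this
  have hc0 : 0 ≤ c := Finset.sum_nonneg fun i _ => neg_nonneg.2 (hneg i)
  have hc' : ∑ i, f (e i) = -c := by rw [hc, Finset.sum_neg_distrib, neg_neg]
  have hcpos : 0 < c := by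
    rcases hc0.lt_or_eq with h' | h'
    · exact h'
    exfalso
    have hz : ∀ i, f (e i) = 0 := by
      have := (Finset.sum_eq_zero_iff_of_nonneg
        (fun i (_ : i ∈ Finset.univ) => neg_nonneg.2 (hneg i))).1 h'.symm
      intro i; linarith [this i (Finset.mem_univ i)]
    -- A zero functional would give `0 < a < b < 0`, where `0 < a` needs some column; `h` at a point
    -- mass supplies one.
    obtain ⟨i0⟩ := ‹Nonempty ι›
    obtain ⟨j, -⟩ := h (Pi.single i0 1) (fun i => by
      rw [Pi.single_apply]; split_ifs <;> norm_num) (by simp)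
    have h1 := hκ j
    simp only [hz, mul_zero, Finset.sum_const_zero] at h1 hv
    linarith
  obtain ⟨j, hj⟩ := h (fun i => -f (e i) / c)
    (fun i => div_nonneg (neg_nonneg.2 (hneg i)) hc0)
    (by rw [← Finset.sum_div, ← hc, div_self hcpos.ne'])
  have h2 : ∑ i, -f (e i) / c * M i j = -(∑ i, M i j * f (e i)) / c := by
    rw [← Finset.sum_neg_distrib, Finset.sum_div]
    exact Finset.sum_congr rfl fun i _ => by ring
  rw [h2, div_le_iff₀ hcpos] at hj
  have h1 := hκ j
  rw [hc'] at hv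
  linarith

/-! VC dimension: finiteness of the dual, and comparison with shattering for set families. -/

theorem Shatters.card_le_vcDim {X : Type*} {F : Set (X → Bool)} {S : Finset X}
    (h : Shatters F S) : (S.card : ℕ∞) ≤ vcDim F :=
  le_iSup₂_of_le S h le_rfl

theorem Shatters.mono {X : Type*} {F : Set (X → Bool)} {S S' : Finset X}
    (h : Shatters F S) (hS : S' ⊆ S) : Shatters F S' := fun y =>
  let ⟨f, hf, hy⟩ := h y
  ⟨f, hf, fun x hx => hy x (hS hx)⟩

theorem vcDim_le_iff {X : Type*} {F : Set (X → Bool)} {d : ℕ∞} :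
    vcDim F ≤ d ↔ ∀ S : Finset X, Shatters F S → (S.card : ℕ∞) ≤ d := by
  simp [vcDim]

theorem exists_shatters_of_le_vcDim {X : Type*} {F : Set (X → Bool)} {n : ℕ} (hn : 1 ≤ n)
    (h : (n : ℕ∞) ≤ vcDim F) : ∃ S : Finset X, Shatters F S ∧ S.card = n := by
  by_contra! hcon
  have hle : vcDim F ≤ ((n - 1 : ℕ) : ℕ∞) := by
    rw [vcDim_le_iff]
    intro S hS
    by_contra! hlt
    have hlt' : n - 1 < S.card := by exact_mod_cast hlt
    obtain ⟨S', hS', hcard⟩ := Finset.exists_subset_card_eq (show n ≤ S.card by omega)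
    exact hcon S' (hS.mono hS') hcard
  have : n ≤ n - 1 := by exact_mod_cast h.trans hle
  omega

/-- Assouad's bound on the dual VC dimension. -/
theorem dualVcDim_lt_of_vcDim_lt {X : Type*} {F : Set (X → Bool)} {n : ℕ}
    (h : vcDim F < n) : dualVcDim F < ((2 ^ n : ℕ) : ℕ∞) := by
  classical
  by_contra! hcon
  obtain ⟨S, hS, hcard⟩ := exists_shatters_of_le_vcDim Nat.one_le_two_pow hcon
  -- Index `2 ^ n` dually shattered functions by bit vectors; the `i`-th bit is a labelling of them,
  -- realized by evaluation at some point `x i`.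
  have e : (Fin n → Bool) ≃ S := Fintype.equivOfCardEq (by simp [hcard])
  have hx : ∀ i : Fin n, ∃ x : X, ∀ b : Fin n → Bool, (e b).1.1 x = b i := by
    intro i
    obtain ⟨g, ⟨x, rfl⟩, hg⟩ := hS fun f => if hf : f ∈ S then e.symm ⟨f, hf⟩ i else false
    refine ⟨x, fun b => ?_⟩
    have := hg (e b).1 (e b).2
    simpa using this
  choose x hx using hx
  have hinj : Function.Injective x := by
    intro i j hij
    by_contra hne
    have h1 := hx i fun k => decide (k = i)
    have h2 := hx j fun k => decide (k = i)
    rw [hij, h2] at h1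
    simp [Ne.symm hne] at h1
  have hsh : Shatters F (Finset.univ.image x) := by
    intro y
    refine ⟨(e fun i => y (x i)).1.1, (e fun i => y (x i)).1.2, ?_⟩
    intro z hz
    obtain ⟨i, -, rfl⟩ := Finset.mem_image.1 hz
    exact hx i _
  have := hsh.card_le_vcDim
  rw [Finset.card_image_of_injective _ hinj, Finset.card_univ, Fintype.card_fin] at this
  exact absurd h (not_lt.2 this)

/-- A set family of disagreement sets of `F` with a fixed function, pulled back along `u`, has VC
dimension at most that of `F`. -/
theorem card_le_of_shatters_disagreement {X ι : Type*} [DecidableEq ι] {F : Set (X → Bool)} {d : ℕ}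
    (hd : vcDim F ≤ d) (u : ι → X) (b : X → Bool) (𝒜 : Finset (Finset ι))
    (h𝒜 : ∀ A ∈ 𝒜, ∃ g ∈ F, ∀ i, i ∈ A ↔ g (u i) ≠ b (u i)) (s : Finset ι)
    (hs : 𝒜.Shatters s) : s.card ≤ d := by
  classical
  -- Membership in a set of the family depends only on `u i`, whereas shattering isolates single
  -- indices.
  have hinj : Set.InjOn u s := by
    intro i hi j hj hij
    obtain ⟨A, hA, hsA⟩ := hs.exists_inter_eq_singleton hi
    obtain ⟨g, -, hg⟩ := h𝒜 A hA
    have hiA : i ∈ A := by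
      have : i ∈ s ∩ A := by rw [hsA]; exact Finset.mem_singleton_self i
      exact (Finset.mem_inter.1 this).2
    have hjA : j ∈ A := by rw [hg, ← hij]; exact (hg i).1 hiA
    have : j ∈ s ∩ A := Finset.mem_inter.2 ⟨hj, hjA⟩
    rw [hsA, Finset.mem_singleton] at this
    exact this.symm
  have hsh : Shatters F (s.image u) := by
    intro y
    obtain ⟨A, hA, hsA⟩ := hs (Finset.filter_subset (fun i => y (u i) ≠ b (u i)) s)
    obtain ⟨g, hgF, hg⟩ := h𝒜 A hA
    refine ⟨g, hgF, fun z hz => ?_⟩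
    obtain ⟨i, hi, rfl⟩ := Finset.mem_image.1 hz
    have h1 : i ∈ A ↔ y (u i) ≠ b (u i) := by
      have := congrArg (i ∈ ·) hsA
      simpa [hi] using this
    rw [hg i] at h1
    revert h1
    cases g (u i) <;> cases y (u i) <;> cases b (u i) <;> simp
  have := hsh.card_le_vcDim.trans hd
  rw [Finset.card_image_of_injOn hinj] at this
  exact_mod_cast this

/-! Chains of thought and prefixes. -/

theorem getElem_iterate_applyAppend (f : List Bool → Bool) (x : List Bool) {T i : ℕ} (hi : i < T)
    (h : x.length + i < ((applyAppend f)^[T] x).length) :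
    ((applyAppend f)^[T] x)[x.length + i] = f ((applyAppend f)^[i] x) := by
  induction T with
  | zero => omega
  | succ T ih =>
    have hlen := length_iterate_applyAppend f T x
    simp only [Function.iterate_succ_apply', applyAppend] at h ⊢
    rcases Nat.lt_succ_iff_lt_or_eq.1 hi with hlt | rfl
    · rw [List.getElem_append_left (by omega)]
      exact ih hlt _
    · rw [List.getElem_append_right (by omega)]
      simp only [List.getElem_singleton]

theorem cot_apply (f : List Bool → Bool) (T : ℕ) (x : List Bool) (i : Fin T) :
    cot f T x i = f ((applyAppend f)^[i] x) :=
  getElem_iterate_applyAppend f x i.2 _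

/-- Two generators have the same chain of thought on `x` if and only if they agree on all prefixes
read during the generation. -/
theorem cot_eq_iff (f g : List Bool → Bool) (T : ℕ) (x : List Bool) :
    cot g T x = cot f T x ↔
      ∀ t : Fin T, g ((applyAppend f)^[t] x) = f ((applyAppend f)^[t] x) := by
  -- The disjunction serves both directions: its alternatives coincide once the iterates have been
  -- shown equal.
  have hiter : (∀ t : Fin T, g ((applyAppend g)^[t] x) = f ((applyAppend f)^[t] x) ∨
      g ((applyAppend f)^[t] x) = f ((applyAppend f)^[t] x)) →
      ∀ n ≤ T, (applyAppend g)^[n] x = (applyAppend f)^[n] x := by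
    intro h n
    induction n with
    | zero => intro _; rfl
    | succ n ih =>
      intro hn
      have hn' := ih (by omega)
      rw [Function.iterate_succ_apply', Function.iterate_succ_apply', hn']
      have h2 := h ⟨n, hn⟩
      simp only [hn', or_self] at h2
      simp only [applyAppend, h2]
  constructor
  · intro h t
    have h1 : ∀ t : Fin T, g ((applyAppend g)^[t] x) = f ((applyAppend f)^[t] x) := fun t => by
      have := congrFun h t
      rwa [cot_apply, cot_apply] at this
    rw [← hiter (fun t => Or.inl (h1 t)) t t.2.le, hiter (fun t => Or.inl (h1 t)) t t.2.le]
    rw [← h1 t, hiter (fun t => Or.inl (h1 t)) t t.2.le]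
  · intro h
    funext t
    rw [cot_apply, cot_apply, hiter (fun t => Or.inr (h t)) t t.2.le, h t]

/-! The sample compression scheme. -/

open Classical in
/-- A function in `F` whose chains of thought fit the given examples, if there is one. -/
noncomputable def fit (F : Set (List Bool → Bool)) (T : ℕ) {m : ℕ}
    (s : Fin m → List Bool × (Fin T → Bool)) : List Bool → Bool :=
  if h : ∃ f ∈ F, ∀ i, cot f T (s i).1 = (s i).2 then h.choose else fun _ => false

theorem fit_spec {F : Set (List Bool → Bool)} {T m : ℕ} {f : List Bool → Bool} (hf : f ∈ F)
    (x : Fin m → List Bool) :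
    fit F T (fun i => (x i, cot f T (x i))) ∈ F ∧
      ∀ i, cot (fit F T fun i => (x i, cot f T (x i))) T (x i) = cot f T (x i) := by
  have h : ∃ g ∈ F, ∀ i, cot g T (x i) = cot f T (x i) := ⟨f, hf, fun _ => rfl⟩
  unfold fit
  rw [dif_pos h]
  exact h.choose_spec

/-- The majority vote of functions fitted to `r` groups of `m` examples each. -/
noncomputable def majorityFit (F : Set (List Bool → Bool)) (T : ℕ) {r m : ℕ}
    (s : Fin r × Fin m → List Bool × (Fin T → Bool)) (u : List Bool) : Bool :=
  decide (r < 2 * (Finset.univ.filter fun j : Fin r => fit F T (fun l => s (j, l)) u = true).card)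

/-- Chain-of-thought data realizable by `F` can be compressed to a number of examples linear in
the product of the VC dimension and the dual VC dimension. -/
theorem exists_compression {F : Set (List Bool → Bool)} {d d' n : ℕ} (hd : 1 ≤ d) (hd' : 1 ≤ d')
    (hF : vcDim F ≤ d) (hF' : dualVcDim F ≤ d') {T : ℕ} (hT : 1 ≤ T) {f : List Bool → Bool}
    (hf : f ∈ F) (hn : 1 ≤ n) (x : Fin n → List Bool) :
    ∃ c : Fin (1008 * d') × Fin (1008 * d) → Fin n, ∀ i,
      cot (majorityFit F T fun a => (x (c a), cot f T (x (c a)))) T (x i) = cot f T (x i) := by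
  classical
  set r := 1008 * d' with hr
  set m := 1008 * d with hm
  set u : Fin n × Fin T → List Bool := fun p => (applyAppend f)^[p.2] (x p.1) with hu
  set h : (Fin m → Fin n) → List Bool → Bool :=
    fun c => fit F T fun l => (x (c l), cot f T (x (c l))) with hh
  have hhF : ∀ c, h c ∈ F := fun c => (fit_spec hf fun l => x (c l)).1
  have hfit : ∀ (c : Fin m → Fin n) l t, h c (u (c l, t)) = f (u (c l, t)) := fun c l t =>
    (cot_eq_iff f (h c) T (x (c l))).1 ((fit_spec hf fun l => x (c l)).2 l) t
  have : Nonempty (Fin n × Fin T) := ⟨(⟨0, hn⟩, ⟨0, hT⟩)⟩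
  -- weak learning
  set err : (Fin m → Fin n) → Finset (Fin n × Fin T) :=
    fun c => Finset.univ.filter fun p => h c (u p) ≠ f (u p) with herr
  obtain ⟨q, hq0, hq1, hq⟩ := exists_mixed_response (fun p c => indic (err c) p) (1 / 6) (by
    intro p hp0 hp1
    obtain ⟨y, hy⟩ := exists_approximation p hp0 hp1 (Finset.univ.image err) hd
      (card_le_of_shatters_disagreement hF u f _ fun A hA => by
        obtain ⟨c, -, rfl⟩ := Finset.mem_image.1 hA
        exact ⟨h c, hhF c, fun i => by simp [herr]⟩)
    -- Only the example of each drawn pair is kept: fitting its whole chain makes `h c` correct at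
    -- every step, in particular at the drawn one.
    set c : Fin m → Fin n := fun l => (y l).1
    refine ⟨c, ?_⟩
    have h1 := hy (err c) (Finset.mem_image_of_mem _ (Finset.mem_univ c))
    have h2 : ∑ l, indic (err c) (y l) = 0 := by
      refine Finset.sum_eq_zero fun l _ => ?_
      have : h c (u (y l)) = f (u (y l)) := hfit c l (y l).2
      simp [indic, herr, this]
    rw [h2, zero_sub, abs_neg] at h1
    have hmpos : (0 : ℝ) < (1008 * d : ℕ) := by exact_mod_cast (by omega : 0 < 1008 * d)
    have h3 := (le_abs_self _).trans h1
    have h4 : ((1008 * d : ℕ) : ℝ) * ∑ a, p a * indic (err c) a ≤ (1008 * d : ℕ) * (1 / 6) := by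
      linarith
    exact le_of_mul_le_mul_left h4 hmpos)
  -- sparsification
  set pos : Fin n × Fin T → Finset (Fin m → Fin n) :=
    fun p => Finset.univ.filter fun c => h c (u p) = true with hpos
  obtain ⟨C, hC⟩ := exists_approximation q hq0 hq1 (Finset.univ.image pos) hd'
    (card_le_of_shatters_disagreement hF' (fun c => (⟨h c, hhF c⟩ : F)) (fun _ => false) _
      fun A hA => by
        obtain ⟨p, -, rfl⟩ := Finset.mem_image.1 hA
        exact ⟨_, ⟨u p, rfl⟩, fun c => by simp [hpos]⟩)
  refine ⟨fun a => C a.1 a.2, fun i => ?_⟩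
  rw [cot_eq_iff]
  intro t
  set p : Fin n × Fin T := (i, t)
  change majorityFit F T _ (u p) = f (u p)
  have h1 := hC (pos p) (Finset.mem_image_of_mem _ (Finset.mem_univ p))
  have hcount : ∑ j, indic (pos p) (C j) =
      ((Finset.univ.filter fun j : Fin r => h (C j) (u p) = true).card : ℝ) := by
    simp only [indic, hpos, Finset.mem_filter, Finset.mem_univ, true_and, Finset.sum_boole]
    rfl
  have hmaj : majorityFit F T (fun a : Fin r × Fin m => (x (C a.1 a.2), cot f T (x (C a.1 a.2))))
      (u p) = decide (r < 2 * (Finset.univ.filter fun j : Fin r => h (C j) (u p) = true).card) :=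
    rfl
  rw [hmaj]
  rw [hcount] at h1
  set N := (Finset.univ.filter fun j : Fin r => h (C j) (u p) = true).card
  have hrpos : (0 : ℝ) < r := by exact_mod_cast (by omega : 0 < r)
  obtain ⟨h2, h3⟩ := abs_le.1 h1
  have hqp := hq p
  have hr' : ((1008 * d' : ℕ) : ℝ) = r := rfl
  rw [hr'] at h2 h3
  set Q := ∑ c, q c * indic (pos p) c with hQ
  cases hfp : f (u p)
  · have h4 : ∑ c, q c * indic (err c) p = Q := by
      refine Finset.sum_congr rfl fun c _ => ?_
      simp [indic, herr, hpos, hfp]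
    rw [h4] at hqp
    rw [decide_eq_false_iff_not, not_lt]
    -- The wrong votes have mass at most `1/6` in the mixture, plus `1/6` for the approximation: a
    -- fraction at most `1/3`.
    have : (2 * N : ℝ) ≤ r := by nlinarith
    exact_mod_cast this
  · have h4 : ∑ c, q c * indic (err c) p = 1 - Q := by
      rw [← hq1, hQ, ← Finset.sum_sub_distrib]
      refine Finset.sum_congr rfl fun c _ => ?_
      simp only [indic, herr, hpos, hfp, Finset.mem_filter, Finset.mem_univ, true_and]
      cases h c (u p) <;> simp
    rw [h4] at hqp
    rw [decide_eq_true_iff]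
    have : (r : ℝ) < 2 * N := by nlinarith
    exact_mod_cast this

/-! Generalization of sample compression schemes. -/

section Compression

variable {X Y κ : Type*} [MeasurableSpace X]

theorem loss_le_one (D : Measure X) [IsProbabilityMeasure D] (f h : X → Y) : loss D f h ≤ 1 :=
  measureReal_le_one

theorem loss_self (D : Measure X) (f : X → Y) : loss D f f = 0 := by simp [loss]

variable [Countable X] [MeasurableSingletonClass X]

theorem measure_agree_le_exp (D : Measure X) [IsProbabilityMeasure D] {f h : X → Y} {ε : ℝ}
    (hε : ε < loss D f h) : D {x | h x = f x} ≤ ENNReal.ofReal (Real.exp (-ε)) := by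
  rw [← ofReal_measureReal]
  refine ENNReal.ofReal_le_ofReal ?_
  have hc : {x | h x = f x} = {x | h x ≠ f x}ᶜ := by ext; simp
  rw [hc, probReal_compl_eq_one_sub (Set.to_countable _).measurableSet]
  have := Real.add_one_le_exp (-ε)
  unfold loss at hε
  linarith

/-- A hypothesis computed from part of a sample is unlikely to be both bad and consistent with the
rest of the sample. -/
theorem pi_bad_consistent_le [Finite κ] (D : Measure X) [IsProbabilityMeasure D] (f : X → Y)
    (ρ : (κ → X) → X → Y) {n : ℕ} (c : κ → Fin n) {ε : ℝ} (hε : 0 < ε) :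
    (Measure.pi fun _ : Fin n => D).real
      {x | ε < loss D f (ρ (x ∘ c)) ∧ ∀ i, ρ (x ∘ c) (x i) = f (x i)} ≤
      Real.exp (-(ε * (n - Nat.card κ))) := by
  classical
  have := Fintype.ofFinite κ
  -- Fix the coordinates read through `c`. The hypothesis is then fixed, and at least `n - Nat.card
  -- κ` independent points remain to test it.
  set p : Fin n → Prop := fun i => i ∈ Set.range c with hp
  set g : ({i // p i} → X) → X → Y := fun a => ρ fun j => a ⟨c j, j, rfl⟩ with hg
  set E : Set (({i // p i} → X) × ({i // ¬ p i} → X)) :=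
    {ab | ε < loss D f (g ab.1) ∧ ∀ j, g ab.1 (ab.2 j) = f (ab.2 j)} with hE
  have hmp := measurePreserving_piEquivPiSubtypeProd (fun _ : Fin n => D) p
  have hsub : {x : Fin n → X | ε < loss D f (ρ (x ∘ c)) ∧ ∀ i, ρ (x ∘ c) (x i) = f (x i)} ⊆
      (MeasurableEquiv.piEquivPiSubtypeProd (fun _ : Fin n => X) p) ⁻¹' E := by
    rintro x ⟨h1, h2⟩
    exact ⟨h1, fun j => h2 j⟩
  have hEm : MeasurableSet E := (Set.to_countable _).measurableSet
  have hbound : ∀ a : {i // p i} → X, (Measure.pi fun _ : {i // ¬ p i} => D) (Prod.mk a ⁻¹' E) ≤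
      ENNReal.ofReal (Real.exp (-(ε * (n - Nat.card κ)))) := by
    intro a
    by_cases ha : ε < loss D f (g a)
    · have h1 : Prod.mk a ⁻¹' E = Set.pi Set.univ fun _ => {x | g a x = f x} := by
        ext b; simp [hE, ha]
      rw [h1, Measure.pi_pi, Finset.prod_const, Finset.card_univ]
      refine (pow_le_pow_left' (measure_agree_le_exp D ha) _).trans ?_
      rw [← ENNReal.ofReal_pow (Real.exp_pos _).le, ← Real.exp_nat_mul]
      refine ENNReal.ofReal_le_ofReal (Real.exp_le_exp.2 ?_)
      have hcard : (n : ℝ) - Nat.card κ ≤ Fintype.card {i // ¬ p i} := by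
        have h2 : Fintype.card {i // p i} ≤ Fintype.card κ :=
          Fintype.card_range_le c
        have h3 := Fintype.card_subtype_compl p
        rw [Fintype.card_fin] at h3
        rw [Nat.card_eq_fintype_card, sub_le_iff_le_add]
        exact_mod_cast (by omega :
          n ≤ Fintype.card {i // ¬ p i} + Fintype.card κ)
      nlinarith
    · have h1 : Prod.mk a ⁻¹' E = ∅ := by
        ext b; simp [hE, ha]
      rw [h1, measure_empty]; exact zero_le
  have hmain : (Measure.pi fun _ : Fin n => D)
      {x | ε < loss D f (ρ (x ∘ c)) ∧ ∀ i, ρ (x ∘ c) (x i) = f (x i)} ≤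
      ENNReal.ofReal (Real.exp (-(ε * (n - Nat.card κ)))) := by
    refine (measure_mono hsub).trans ?_
    rw [hmp.measure_preimage hEm.nullMeasurableSet, Measure.prod_apply hEm]
    refine (lintegral_mono hbound).trans ?_
    simp
  exact ENNReal.toReal_le_of_le_ofReal (Real.exp_pos _).le hmain

open Classical in
/-- The learner of a compression scheme with reconstruction map `ρ`: search for a subsample whose
reconstruction is consistent with the whole sample. -/
noncomputable def compressionLearner [Inhabited Y] (ρ : (κ → X × Y) → X → Y)
    (L : List (X × Y)) : X → Y :=
  if h : ∃ s : κ → X × Y, (∀ j, s j ∈ L) ∧ ∀ p ∈ L, ρ s p.1 = p.2 then ρ h.choose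
  else default

/-- The chosen subsample comes from one of `n ^ Nat.card κ` index maps and its reconstruction is
consistent, so `pi_bad_consistent_le` and a union bound apply. -/
theorem pi_compressionLearner_le [Finite κ] [Inhabited Y] (ρ : (κ → X × Y) → X → Y) (D : Measure X)
    [IsProbabilityMeasure D] (f : X → Y) {n : ℕ}
    (hcomp : ∀ x : Fin n → X, ∃ c : κ → Fin n, ∀ i,
      ρ (fun a => (x (c a), f (x (c a)))) (x i) = f (x i)) {ε : ℝ} (hε : 0 < ε) :
    (Measure.pi fun _ : Fin n => D).real
      {x | ε < loss D f (compressionLearner ρ (labeledSample f x))} ≤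
      n ^ Nat.card κ * Real.exp (-(ε * (n - Nat.card κ))) := by
  classical
  have := Fintype.ofFinite κ
  set ρ' : (κ → X) → X → Y := fun s => ρ fun a => (s a, f (s a)) with hρ'
  have hsub : {x : Fin n → X | ε < loss D f (compressionLearner ρ (labeledSample f x))} ⊆
      ⋃ c ∈ (Finset.univ : Finset (κ → Fin n)),
        {x | ε < loss D f (ρ' (x ∘ c)) ∧ ∀ i, ρ' (x ∘ c) (x i) = f (x i)} := by
    intro x hx
    have hex : ∃ s : κ → X × Y, (∀ j, s j ∈ labeledSample f x) ∧
        ∀ p ∈ labeledSample f x, ρ s p.1 = p.2 := by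
      obtain ⟨c, hc⟩ := hcomp x
      refine ⟨fun a => (x (c a), f (x (c a))), fun j => ?_, fun p hp => ?_⟩
      · exact (List.mem_ofFn' _ _).2 ⟨c j, rfl⟩
      · obtain ⟨i, rfl⟩ := (List.mem_ofFn' _ _).1 hp
        exact hc i
    have hx' : ε < loss D f (compressionLearner ρ (labeledSample f x)) := hx
    unfold compressionLearner at hx'
    rw [dif_pos hex] at hx'
    obtain ⟨h1, h2⟩ := hex.choose_spec
    set s := hex.choose
    have h3 : ∀ j, ∃ i, (x i, f (x i)) = s j := fun j => (List.mem_ofFn' _ _).1 (h1 j)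
    choose c hc using h3
    have hs : s = fun a => (x (c a), f (x (c a))) := funext fun j => (hc j).symm
    simp only [Finset.mem_univ, Set.iUnion_true, Set.mem_iUnion]
    refine ⟨c, ?_, fun i => ?_⟩
    · rw [hs] at hx'; exact hx'
    · have := h2 (x i, f (x i)) ((List.mem_ofFn' _ _).2 ⟨i, rfl⟩)
      rw [hs] at this; exact this
  refine (measureReal_mono hsub (measure_ne_top _ _)).trans ((measureReal_biUnion_finset_le _ _).trans ?_)
  refine (Finset.sum_le_card_nsmul _ _ _ fun c _ => pi_bad_consistent_le D f ρ' c hε).trans ?_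
  rw [nsmul_eq_mul, Finset.card_univ, Fintype.card_fun, Fintype.card_fin, Nat.card_eq_fintype_card]
  push_cast
  exact le_rfl

end Compression

/-! The sample size. -/

theorem sampleSize_spec {A k : ℕ} (hA : 1 ≤ A) (hk : 1 ≤ k) {ε δ : ℝ} (hε : 0 < ε) (hε1 : ε < 1)
    (hδ : 0 < δ) (hδ1 : δ < 1) {n : ℕ}
    (hn : n = sampleSize (2 * A * (3 + 2 * A)) k ε δ) :
    1 ≤ n ∧ (n : ℝ) ^ (A * k) * Real.exp (-(ε * (n - (A * k : ℕ)))) ≤ δ := by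
  have hA' : (1 : ℝ) ≤ A := by exact_mod_cast hA
  have hk' : (1 : ℝ) ≤ k := by exact_mod_cast hk
  set C : ℝ := 2 * A * (3 + 2 * A) with hC
  set L := Real.log ((k : ℝ) + 2) with hL
  set l := Real.log (2 / ε) with hl
  set q := Real.log (1 / δ) with hq
  have hL1 : 1 ≤ L := by
    rw [hL, Real.le_log_iff_exp_le (by positivity)]
    have := Real.exp_one_lt_d9; linarith
  have hl1 : 1 / 2 ≤ l := by
    have h1 : Real.log 2 ≤ l := Real.log_le_log (by norm_num) (by
      rw [le_div_iff₀ hε]; linarith)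
    have := Real.log_two_gt_d9; linarith
  have hq0 : 0 < q := Real.log_pos (by rw [lt_div_iff₀ hδ]; linarith)
  have hC2 : 2 ≤ C := by nlinarith only [hC, hA']
  have hLl : 1 / 2 ≤ L * l := by nlinarith only [hL1, hl1]
  have hnum : 0 < k * L * l + q := by positivity
  have hceil : C * (k * L * l + q) / ε ≤ n := by
    rw [hn]; exact Nat.le_ceil _
  have hnpos : (0 : ℝ) < n := lt_of_lt_of_le (by positivity) hceil
  have hn1 : 1 ≤ n := by exact_mod_cast hnpos
  refine ⟨hn1, ?_⟩
  rw [div_le_iff₀ hε] at hceil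
  set s : ℝ := A * k with hs
  have hs1 : 1 ≤ s := by nlinarith only [hs, hA', hk']
  have hB : 0 < 2 * s / ε := by positivity
  -- The bound `log y ≤ y` at `y = n / (2 * s / ε)` spends half of `ε * n`; the other half pays for
  -- the terms free of `n`, whence the factor 2 in `C`.
  have hlogn : s * Real.log n ≤ ε * n / 2 + s * (l + Real.log A + Real.log k) := by
    have h1 : Real.log n = Real.log (n / (2 * s / ε)) + Real.log (2 * s / ε) := by
      rw [← Real.log_mul (by positivity) hB.ne', div_mul_cancel₀ _ hB.ne']
    have h2 : Real.log (2 * s / ε) = l + Real.log A + Real.log k := by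
      rw [show 2 * s / ε = 2 / ε * A * k by rw [hs]; ring,
        Real.log_mul (by positivity) (by positivity), Real.log_mul (by positivity) (by positivity)]
    have h3 : Real.log (n / (2 * s / ε)) ≤ n / (2 * s / ε) :=
      (Real.log_le_sub_one_of_pos (by positivity)).trans (by linarith)
    have h4 : s * (n / (2 * s / ε)) = ε * n / 2 := by field_simp
    rw [h1, h2, mul_add, ← h4]
    gcongr
  have hlogA : Real.log A ≤ A - 1 := Real.log_le_sub_one_of_pos (by positivity)
  have hlogk : Real.log k ≤ L := Real.log_le_log (by positivity) (by linarith)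
  have hlL : l ≤ L * l := by nlinarith only [hL1, hl1]
  have hLlL : L ≤ 2 * (L * l) := by nlinarith only [hL1, hl1]
  have hAL : (A : ℝ) ≤ 2 * A * (L * l) := by nlinarith only [hA', hLl]
  have hsum : l + Real.log A + Real.log k + 1 ≤ (3 + 2 * A) * (L * l) := by
    linarith only [hlogA, hlogk, hlL, hLlL, hAL]
  have hs2 : s * (l + Real.log A + Real.log k + 1) ≤ s * ((3 + 2 * A) * (L * l)) := by gcongr
  have hs3 : 2 * (s * ((3 + 2 * A) * (L * l))) = C * (k * L * l) := by rw [hs, hC]; ring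
  have hεs : ε * s ≤ s := by nlinarith only [hs1, hε1]
  have hqC : 2 * q ≤ C * q := by gcongr
  have hfinal : s * Real.log n - ε * (n - s) ≤ Real.log δ := by
    have h1 : Real.log δ = -q := by rw [hq, one_div, Real.log_inv, neg_neg]
    rw [h1]
    linarith only [hlogn, hs2, hs3, hεs, hqC, hceil]
  rw [← Real.exp_log hnpos, ← Real.exp_nat_mul, ← Real.exp_add, Real.exp_log hnpos,
    ← Real.le_log_iff_exp_le hδ]
  push_cast
  rw [← hs]
  linarith

/-! Learnability. -/

section Learning

variable {F : Set (List Bool → Bool)}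

/-- If two functions of `F` that agree anywhere are equal, one example suffices. -/
theorem eq_of_apply_eq (h : vcDim F = 0 ∨ dualVcDim F = 0) {f g : List Bool → Bool} (hf : f ∈ F)
    (hg : g ∈ F) {x : List Bool} (hx : f x = g x) : f = g := by
  funext z
  by_contra hne
  rcases h with h | h
  · have hsh : Shatters F {z} := by
      intro y
      by_cases hy : f z = y z
      · exact ⟨f, hf, by simpa using hy⟩
      · refine ⟨g, hg, ?_⟩
        simp only [Finset.mem_singleton, forall_eq]
        revert hne hy
        cases f z <;> cases g z <;> cases y z <;> simp
    have := hsh.card_le_vcDim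
    rw [h] at this
    simp at this
  · have hconst : ∀ f₀ ∈ F, f₀ x = f₀ z := by
      intro f₀ hf₀
      by_contra hne'
      have hsh : Shatters (dualClass F) {⟨f₀, hf₀⟩} := by
        intro y
        by_cases hy : f₀ x = y ⟨f₀, hf₀⟩
        · exact ⟨_, ⟨x, rfl⟩, by simpa using hy⟩
        · refine ⟨_, ⟨z, rfl⟩, ?_⟩
          simp only [Finset.mem_singleton, forall_eq]
          revert hne' hy
          cases f₀ x <;> cases f₀ z <;> cases y ⟨f₀, hf₀⟩ <;> simp
      have := hsh.card_le_vcDim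
      change _ ≤ dualVcDim F at this
      rw [h] at this
      simp at this
    exact hne (by rw [← hconst f hf, ← hconst g hg, hx])

/-- To prove learnability it suffices to treat accuracies and confidences below `1`. -/
theorem learnableWith_of_lt_one {X Y : Type*} [MeasurableSpace X] {H : Set (X → Y)}
    {m : ℝ → ℝ → ℕ} (Lrn : List (X × Y) → X → Y)
    (h : ∀ D : Measure X, IsProbabilityMeasure D → ∀ ε δ : ℝ, 0 < ε → ε < 1 → 0 < δ → δ < 1 →
      ∀ f ∈ H, (Measure.pi fun _ : Fin (m ε δ) => D).real
        {x | ε < loss D f (Lrn (labeledSample f x))} ≤ δ) : LearnableWith H m := by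
  refine ⟨Lrn, fun D hD ε δ hε hδ f hf => ?_⟩
  rcases lt_or_ge ε 1 with hε1 | hε1
  · rcases lt_or_ge δ 1 with hδ1 | hδ1
    · exact h D hD ε δ hε hε1 hδ hδ1 f hf
    · exact measureReal_le_one.trans hδ1
  · have : {x : Fin (m ε δ) → X | ε < loss D f (Lrn (labeledSample f x))} = ∅ := by
      ext x
      simpa using (loss_le_one D f _).trans hε1
    rw [this, measureReal_empty]
    exact hδ.le

theorem learnableWith_cotClass_of_zero (h : vcDim F = 0 ∨ dualVcDim F = 0) {C : ℝ} (hC : 0 < C)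
    {T : ℕ} (hT : 1 ≤ T) : LearnableWith (cotClass F T) (sampleSize C 0) := by
  classical
  refine learnableWith_of_lt_one (fun L => cot (if hL : ∃ g ∈ F, ∀ p ∈ L, cot g T p.1 = p.2
    then hL.choose else fun _ => false) T) ?_
  rintro D hD ε δ hε hε1 hδ hδ1 _ ⟨f, hf, rfl⟩
  -- For `k = 0` only the confidence term is left; it is positive for `δ < 1`, which guarantees the
  -- one example needed.
  have hn : 0 < sampleSize C 0 ε δ := by
    unfold sampleSize
    rw [Nat.ceil_pos]
    have : 0 < Real.log (1 / δ) := Real.log_pos (by rw [lt_div_iff₀ hδ]; linarith)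
    simp only [CharP.cast_eq_zero, zero_mul, zero_add]
    positivity
  have hempty : {x : Fin (sampleSize C 0 ε δ) → List Bool | ε < loss D (cot f T)
      (cot (if hL : ∃ g ∈ F, ∀ p ∈ labeledSample (cot f T) x, cot g T p.1 = p.2
        then hL.choose else fun _ => false) T)} = ∅ := by
    ext x
    simp only [Set.mem_ofPred_eq, Set.mem_empty_iff_false, iff_false, not_lt]
    have hL : ∃ g ∈ F, ∀ p ∈ labeledSample (cot f T) x, cot g T p.1 = p.2 := by
      refine ⟨f, hf, fun p hp => ?_⟩
      obtain ⟨i, rfl⟩ := (List.mem_ofFn' _ _).1 hp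
      rfl
    rw [dif_pos hL]
    obtain ⟨h1, h2⟩ := hL.choose_spec
    have h3 := h2 _ ((List.mem_ofFn' _ _).2 ⟨⟨0, hn⟩, rfl⟩)
    have h4 := (cot_eq_iff f _ T _).1 h3 ⟨0, hT⟩
    rw [eq_of_apply_eq h h1 hf h4, loss_self]
    exact hε.le
  rw [hempty, measureReal_empty]
  exact hδ.le

theorem learnableWith_cotClass {d d' : ℕ} (hF : vcDim F = d) (hF' : dualVcDim F = d')
    {T : ℕ} (hT : 1 ≤ T) :
    LearnableWith (cotClass F T)
      (sampleSize (2 * (1008 * 1008 : ℕ) * (3 + 2 * (1008 * 1008 : ℕ))) (d * d')) := by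
  rcases Nat.eq_zero_or_pos (d * d') with hk | hk
  · rw [hk]
    refine learnableWith_cotClass_of_zero ?_ (by positivity) hT
    rcases Nat.mul_eq_zero.1 hk with rfl | rfl
    · left; simpa using hF
    · right; simpa using hF'
  have hd : 1 ≤ d := Nat.pos_of_mul_pos_right hk
  have hd' : 1 ≤ d' := Nat.pos_of_mul_pos_left hk
  refine learnableWith_of_lt_one (compressionLearner fun s => cot
    (majorityFit (r := 1008 * d') (m := 1008 * d) F T s) T) ?_
  rintro D hD ε δ hε hε1 hδ hδ1 _ ⟨f, hf, rfl⟩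
  obtain ⟨hn, hsize⟩ := sampleSize_spec (A := 1008 * 1008) (by norm_num) hk hε hε1 hδ hδ1 rfl
  refine (pi_compressionLearner_le _ D (cot f T)
    (exists_compression hd hd' hF.le hF'.le hT hf hn) hε).trans ?_
  have hcard : Nat.card (Fin (1008 * d') × Fin (1008 * d)) = 1008 * 1008 * (d * d') := by
    rw [Nat.card_eq_fintype_card, Fintype.card_prod, Fintype.card_fin, Fintype.card_fin]; ring
  rw [hcard]
  exact hsize

/-- A wrong last symbol makes the whole chain wrong, so reading off the last predicted symbol does
not increase the loss. -/
theorem CoTLearnableWith.of_learnableWith {T : ℕ} (hT : 1 ≤ T) {m : ℝ → ℝ → ℕ}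
    (h : LearnableWith (cotClass F T) m) : CoTLearnableWith F T hT m := by
  obtain ⟨Lrn, hL⟩ := h
  refine ⟨fun L x => Lrn L x ⟨T - 1, Nat.sub_lt hT Nat.one_pos⟩,
    fun D hD ε δ hε hδ f hf => le_trans (measureReal_mono fun x hx => ?_)
      (hL D hD ε δ hε hδ (cot f T) ⟨f, hf, rfl⟩)⟩
  refine lt_of_lt_of_le (show ε < _ from hx) (measureReal_mono fun z hz => ?_)
  exact fun heq => hz (congrFun heq _)

end Learning

/-! Classes of infinite VC dimension are not learnable. -/

/-- A Chernoff-type bound on the size of a Hamming ball of relative radius `1/8`. -/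
theorem card_hammingBall_le (M : ℕ) (b : Fin (8 * M) → Bool) :
    (Finset.univ.filter fun y : Fin (8 * M) → Bool =>
      (Finset.univ.filter fun i => b i ≠ y i).card ≤ M).card ≤ 32 ^ M := by
  classical
  set B := Finset.univ.filter fun y : Fin (8 * M) → Bool =>
      (Finset.univ.filter fun i => b i ≠ y i).card ≤ M
  -- Exponential weighting by distance with base `1/16`; it suffices that `(17/16) ^ 8 ≤ 2`.
  have h1 : (B.card : ℝ) * (1 / 16) ^ M ≤ (17 / 16) ^ (8 * M) := by
    calc (B.card : ℝ) * (1 / 16) ^ M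
        = ∑ _y ∈ B, (1 / 16 : ℝ) ^ M := by rw [Finset.sum_const, nsmul_eq_mul]
      _ ≤ ∑ y ∈ B, (1 / 16 : ℝ) ^ (Finset.univ.filter fun i => b i ≠ y i).card := by
          refine Finset.sum_le_sum fun y hy => ?_
          exact pow_le_pow_of_le_one (by norm_num) (by norm_num) (Finset.mem_filter.1 hy).2
      _ ≤ ∑ y : Fin (8 * M) → Bool,
            (1 / 16 : ℝ) ^ (Finset.univ.filter fun i => b i ≠ y i).card :=
          Finset.sum_le_sum_of_subset_of_nonneg (Finset.subset_univ _)
            fun _ _ _ => by positivity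
      _ = ∑ y : Fin (8 * M) → Bool, ∏ i, (if b i ≠ y i then (1 / 16 : ℝ) else 1) := by
          refine Finset.sum_congr rfl fun y _ => ?_
          rw [Finset.prod_ite, Finset.prod_const, Finset.prod_const_one, mul_one]
      _ = ∏ i, ∑ v : Bool, (if b i ≠ v then (1 / 16 : ℝ) else 1) := by
          rw [← Fintype.piFinset_univ, Finset.sum_prod_piFinset Finset.univ
            fun i v => if b i ≠ v then (1 / 16 : ℝ) else 1]
      _ = (17 / 16) ^ (8 * M) := by
          refine (Finset.prod_eq_pow_card (b := (17 / 16 : ℝ)) fun i _ => ?_).trans (by simp)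
          rw [Fintype.sum_bool]
          cases b i <;> norm_num
  have h2 : (B.card : ℝ) ≤ 32 ^ M := by
    have h3 : (17 / 16 : ℝ) ^ (8 * M) ≤ 32 ^ M * (1 / 16) ^ M := by
      rw [pow_mul, ← mul_pow]
      gcongr
      norm_num
    exact le_of_mul_le_mul_right (h1.trans h3) (by positivity)
  exact_mod_cast h2

/-- The uniform distribution on the values of `p`. -/
noncomputable def uniformOnRange {X : Type*} [MeasurableSpace X] {N : ℕ} (p : Fin N → X) :
    Measure X :=
  (N : ENNReal)⁻¹ • ∑ i, Measure.dirac (p i)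

theorem uniformOnRange_isProbabilityMeasure {X : Type*} [MeasurableSpace X] {N : ℕ} (hN : N ≠ 0)
    (p : Fin N → X) : IsProbabilityMeasure (uniformOnRange p) := by
  constructor
  simp [uniformOnRange, ENNReal.inv_mul_cancel, hN]

open Classical in
theorem uniformOnRange_real {X : Type*} [MeasurableSpace X] {N : ℕ} (p : Fin N → X) {A : Set X}
    (hA : MeasurableSet A) :
    (uniformOnRange p).real A = (N : ℝ)⁻¹ * (Finset.univ.filter fun i => p i ∈ A).card := by
  simp [uniformOnRange, Measure.real, Measure.dirac_apply' _ hA, Set.indicator_apply,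
    Finset.sum_boole]

/-- If every point lies in at most `K` of finitely many events, their probabilities sum to at most
`K`. -/
theorem sum_measureReal_le_of_card_le {Ω ι : Type*} [Fintype ι] [MeasurableSpace Ω] (μ : Measure Ω)
    [IsProbabilityMeasure μ] (G : ι → Set Ω) (hG : ∀ y, MeasurableSet (G y)) (K : ℕ)
    (hK : ∀ x, ∀ s : Finset ι, (∀ y ∈ s, x ∈ G y) → s.card ≤ K) :
    ∑ y, μ.real (G y) ≤ K := by
  classical
  have h : ∑ y, μ (G y) ≤ K := by
    calc ∑ y, μ (G y) = ∑ y, ∫⁻ x, (G y).indicator 1 x ∂μ := by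
          refine Finset.sum_congr rfl fun y _ => ?_
          rw [lintegral_indicator_one (hG y)]
      _ = ∫⁻ x, ∑ y, (G y).indicator 1 x ∂μ := by
          rw [lintegral_finsetSum]
          exact fun y _ => measurable_one.indicator (hG y)
      _ ≤ ∫⁻ _, (K : ENNReal) ∂μ := by
          refine lintegral_mono fun x => ?_
          simp only [Set.indicator_apply, Pi.one_apply, Finset.sum_boole]
          exact_mod_cast hK x _ fun y hy => (Finset.mem_filter.1 hy).2
      _ = K := by simp
  have h' := ENNReal.toReal_mono (ENNReal.natCast_ne_top K) h
  rw [ENNReal.toReal_sum fun y _ => measure_ne_top μ _] at h'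
  simpa [Measure.real] using h'

theorem not_learnable_cotClass {F : Set (List Bool → Bool)} (hF : vcDim F = ⊤) {T : ℕ}
    (hT : 1 ≤ T) : ¬ Learnable (cotClass F T) := by
  classical
  rintro ⟨sz, Lrn, hL⟩
  set n := sz (1 / 8) (1 / 2) with hn
  -- Chosen so that half of the `2 ^ (8 * M)` labellings, `4 ^ M * 2 ^ (n * T) * 32 ^ M`, exceeds
  -- the number `2 ^ (n * T) * 32 ^ M` that can be learned from one sample.
  set M := n * T + 1 with hM
  obtain ⟨S, hS, hcard⟩ := exists_shatters_of_le_vcDim (F := F) (n := 8 * M) (by omega)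
    (by rw [hF]; exact le_top)
  have e : Fin (8 * M) ≃ S := Fintype.equivOfCardEq (by simp [hcard])
  set p : Fin (8 * M) → List Bool := fun i => (e i).1 with hp
  have hf : ∀ y : Fin (8 * M) → Bool, ∃ f ∈ F, ∀ i, f (p i) = y i := by
    intro y
    obtain ⟨f, hfF, hf⟩ := hS fun x => if hx : x ∈ S then y (e.symm ⟨x, hx⟩) else false
    refine ⟨f, hfF, fun i => ?_⟩
    rw [hf (p i) (e i).2]
    simp [hp]
  choose f hfF hf using hf
  set D := uniformOnRange p with hD
  have : IsProbabilityMeasure D := uniformOnRange_isProbabilityMeasure (by omega) p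
  have hMpos : (0 : ℝ) < M := by positivity
  -- The first symbol of the chain on `p i` is `y i`, so small loss already forces few mistakes on
  -- the labelling.
  have hloss : ∀ y (h : List Bool → Fin T → Bool), loss D (cot (f y) T) h ≤ 1 / 8 →
      (Finset.univ.filter fun i => h (p i) ⟨0, hT⟩ ≠ y i).card ≤ M := by
    intro y h hle
    unfold loss at hle
    rw [hD, uniformOnRange_real p (Set.to_countable _).measurableSet] at hle
    rw [inv_mul_le_iff₀ (by positivity), show ((8 * M : ℕ) : ℝ) * (1 / 8) = M by push_cast; ring,
      Nat.cast_le] at hle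
    refine (Finset.card_le_card fun i hi => ?_).trans hle
    simp only [Finset.mem_filter, Finset.mem_univ, true_and] at hi ⊢
    intro heq
    refine hi ?_
    rw [show h (p i) = _ from heq, cot_apply]
    exact hf y i
  set G : (Fin (8 * M) → Bool) → Set (Fin n → List Bool) := fun y =>
    {x | 1 / 8 < loss D (cot (f y) T) (Lrn (labeledSample (cot (f y) T) x))}ᶜ with hG
  have hup := sum_measureReal_le_of_card_le (Measure.pi fun _ : Fin n => D) G
    (fun y => (Set.to_countable _).measurableSet) (2 ^ (n * T) * 32 ^ M) (by
      intro x s hs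
      -- With the points `x` fixed, the learner sees one of `2 ^ (n * T)` label tables `l`, so its
      -- outputs are covered by that many Hamming balls.
      set b : (Fin n → Fin T → Bool) → Fin (8 * M) → Bool := fun l i =>
        Lrn (List.ofFn fun j => (x j, l j)) (p i) ⟨0, hT⟩ with hb
      have hsub : s ⊆ Finset.univ.biUnion fun l : Fin n → Fin T → Bool =>
          Finset.univ.filter fun y : Fin (8 * M) → Bool =>
            (Finset.univ.filter fun i => b l i ≠ y i).card ≤ M := by
        intro y hy
        simp only [Finset.mem_biUnion, Finset.mem_univ, true_and, Finset.mem_filter]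
        exact ⟨fun j => cot (f y) T (x j), hloss y _ (not_lt.1 (hs y hy))⟩
      refine (Finset.card_le_card hsub).trans (Finset.card_biUnion_le.trans ?_)
      refine (Finset.sum_le_card_nsmul _ _ _ fun l _ => card_hammingBall_le M (b l)).trans ?_
      simp [← pow_mul, mul_comm])
  have hlow : ∀ y, 1 / 2 ≤ (Measure.pi fun _ : Fin n => D).real (G y) := by
    intro y
    have h1 := hL D this (1 / 8) (1 / 2) (by norm_num) (by norm_num) (cot (f y) T)
      ⟨f y, hfF y, rfl⟩
    rw [hG, probReal_compl_eq_one_sub (Set.to_countable _).measurableSet]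
    linarith
  have hsum := (Finset.card_nsmul_le_sum Finset.univ _ _ fun y _ => hlow y).trans hup
  rw [Finset.card_univ, Fintype.card_fun, Fintype.card_bool, Fintype.card_fin, nsmul_eq_mul] at hsum
  push_cast at hsum
  have h1 : (2 : ℝ) ^ (8 * M) = 4 ^ M * (2 ^ M * 32 ^ M) := by
    rw [pow_mul, ← mul_pow, ← mul_pow]; norm_num
  have h2 : (2 : ℝ) ^ M = 2 ^ (n * T) * 2 := by rw [hM, pow_succ]
  have h3 : (1 : ℝ) < 4 ^ M := one_lt_pow₀ (by norm_num) (by omega)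
  rw [h1, h2] at hsum
  have h4 : (0 : ℝ) < 2 ^ (n * T) * 32 ^ M := by positivity
  nlinarith

end Autoregressive

theorem theorem1 :
    (∃ C : ℝ, 0 < C ∧
      ∀ F : Set (List Bool → Bool), Autoregressive.vcDim F < ⊤ →
        Autoregressive.dualVcDim F < ⊤ ∧
        ∀ (T : ℕ) (hT : 1 ≤ T),
          Autoregressive.LearnableWith (Autoregressive.cotClass F T)
            (Autoregressive.sampleSize C
              ((Autoregressive.vcDim F).toNat * (Autoregressive.dualVcDim F).toNat)) ∧
          Autoregressive.CoTLearnableWith F T hT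
            (Autoregressive.sampleSize C
              ((Autoregressive.vcDim F).toNat * (Autoregressive.dualVcDim F).toNat))) ∧
    (∀ F : Set (List Bool → Bool), Autoregressive.vcDim F = ⊤ →
      ∀ T : ℕ, 1 ≤ T → ¬ Autoregressive.Learnable (Autoregressive.cotClass F T)) := by
  refine ⟨⟨2 * (1008 * 1008 : ℕ) * (3 + 2 * (1008 * 1008 : ℕ)), by positivity, fun F hF => ?_⟩,
    fun F hF T hT => Autoregressive.not_learnable_cotClass hF hT⟩
  obtain ⟨d, hd⟩ := ENat.ne_top_iff_exists.1 hF.ne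
  have hF' : Autoregressive.dualVcDim F < ⊤ :=
    (Autoregressive.dualVcDim_lt_of_vcDim_lt (n := d + 1) (by
      rw [← hd]; exact_mod_cast Nat.lt_succ_self d)).trans (ENat.natCast_lt_top _)
  refine ⟨hF', fun T hT => ?_⟩
  obtain ⟨d', hd'⟩ := ENat.ne_top_iff_exists.1 hF'.ne
  have h := Autoregressive.learnableWith_cotClass hd.symm hd'.symm hT
  rw [← hd, ← hd', ENat.toNat_natCast, ENat.toNat_natCast]
  exact ⟨h, Autoregressive.CoTLearnableWith.of_learnableWith hT h⟩
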